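/- Let $k$ be a commutative ring and let $\mathsf{Mod}\,X$ be a $k$-linear, locally noetherian Grothendieck category (it has a set of noetherian generators), whose objects are called $X$-modules. A \emph{big injective} is an indecomposable injective $X$-module $\mathcal E$ such that $\operatorname{End}\mathcal E$ is a division ring and every $X$-module is a subquotient of a direct sum of copies of $\mathcal E$. Suppose that $X$ is \emph{integral}, i.e. that a big injective exists, and let $\mathcal E_X$ be any big injective. Put $k(X)=\operatorname{End}\mathcal E_X$ (the function field). An $X$-module $M$ is \emph{torsion} if $\operatorname{Hom}_X(M,\mathcal E_X)=0$, and $\operatorname{rank} M$ is the length of $\operatorname{Hom}_X(M,\mathcal E_X)$ as a left $k(X)$-module. The generic point $\eta$ of $X$ is defined by $\mathsf{Mod}\,\eta=\mathsf{Mod}\,X/\mathsf T$, where $\mathsf T$ is the Serre subcategory of torsion modules, and $j^*:\mathsf{Mod}\,X\to\mathsf{Mod}\,\eta$ is the quotient functor. Then: (1) There is a $k$-linear equivalence between $\mathsf{Mod}\,\eta$ and the category $\mathsf{Mod}\,k(X)$ of right $k(X)$-modules. (2) For every equivalence $F:\mathsf{Mod}\,\eta\to\mathsf{Mod}\,k(X)$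 and every $X$-module $M$, $\operatorname{rank} M$ equals the length of the right $k(X)$-module $F(j^*M)$ (both are elements of $\mathbb N\cup\{\infty\}$). -/

import Mathlib

open CategoryTheory CategoryTheory.Limits
open scoped ModuleCat.Algebra ZeroObject

universe w v u

namespace NCSpace

/-- A Grothendieck category is locally noetherian if it has a (small) set of noetherian
generators. -/
class IsLocallyNoetherian (C : Type u) [Category.{v} C] [Abelian C] : Prop where
  exists_generators : ∃ (ι : Type v) (G : ι → C),
    (∀ i, IsNoetherianObject (G i)) ∧ (ObjectProperty.ofObj G).IsSeparating

/-- `Q` is a subquotient of `Y`: a quotient of a subobject of `Y`. -/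
def IsSubquotient {C : Type u} [Category.{v} C] (Q Y : C) : Prop :=
  ∃ (S : C) (i : S ⟶ Y) (p : S ⟶ Q), Mono i ∧ Epi p

variable {C : Type u} [Category.{v} C] [Abelian C]

/-- `E` is a big injective: an indecomposable injective object whose endomorphism ring is a
division ring, such that every object is a subquotient of a direct sum of copies of `E`. -/
class IsBigInjective [HasCoproducts.{v} C] (E : C) : Prop where
  injective : Injective E
  indecomposable : Indecomposable E
  isUnit_of_ne_zero : ∀ f : End E, f ≠ 0 → IsUnit f
  isSubquotient : ∀ M : C, ∃ ι : Type v, IsSubquotient M (∐ fun _ : ι => E)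

attribute [instance] IsBigInjective.injective

variable (C) in
/-- The space whose category of modules is the Grothendieck category `C` is integral. -/
class IsIntegralSpace [HasCoproducts.{v} C] : Prop extends IsLocallyNoetherian C where
  exists_bigInjective : ∃ E : C, IsBigInjective E

/-- The torsion modules (with respect to `E`): those `M` with `Hom(M, E) = 0`. -/
def torsion (E : C) : ObjectProperty C := fun M => ∀ f : M ⟶ E, f = 0

instance isSerreClass_torsion (E : C) [Injective E] : (torsion E).IsSerreClass where
  exists_zero := ⟨0, isZero_zero C, fun f => (isZero_zero C).eq_of_src f 0⟩
  prop_of_mono i _ hY f := by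
    rw [← Injective.comp_factorThru f i, hY (Injective.factorThru f i), comp_zero]
  prop_of_epi p _ hX f := by
    rw [← cancel_epi p, hX (p ≫ f), comp_zero]
  prop_X₂_of_shortExact {S} hS h₁ h₃ f := by
    have := hS.epi_g
    have h := h₁ (S.f ≫ f)
    rw [← hS.exact.g_desc f h, h₃ (hS.exact.desc f h), comp_zero]

/-- The function field `k(X) = End E`; the product `f * g` is the composite "`g`, then `f`". -/
abbrev functionField (E : C) : Type v := End E

/-- The rank of `M`: the length of the left `End E`-module `Hom(M, E)`, in `ℕ∞`. -/
noncomputable def rank (E M : C) : ℕ∞ := Module.length (functionField E) (M ⟶ E)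

/-- The category of modules over the generic point: the quotient of `C` by the torsion modules,
that is, the localization of `C` at the morphisms with torsion kernel and torsion cokernel. -/
abbrev GenericPoint (E : C) [Injective E] : Type u := (torsion E).isoModSerre.Localization

/-- The quotient functor `j^*`. -/
abbrev toGenericPoint (E : C) [Injective E] : C ⥤ GenericPoint E := (torsion E).isoModSerre.Q

end NCSpace

/-!
Write `D = End E` and call `∐_J E` a copower of `E`. The quotient category `GenericPoint E` is
described by comparing it with the full subcategory of copowers of `E`.

*Copowers are closed.* `E` is injective, and a morphism from a torsion object to `E` is zero, so
every morphism to `E` extends uniquely along a morphism with torsion kernel and cokernel. The same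
holds for copowers (`eq_of_epiModSerre_comp_eq`, `exists_extension`). This is where the locally
noetherian hypothesis matters: a morphism from a noetherian object to a copower has finitely many nonzero
coordinates (`exists_eq_sum_π`), so that an extension can be built coordinate by coordinate.
Consequently `j^*` is fully faithful on copowers.

*Up to torsion, every object is a copower.* Since `D` is a division ring, a nonzero endomorphism
of `E` is invertible, which makes `E` simple modulo torsion. As for semisimple modules, Zorn's lemma
provides a complement to any subobject of a copower, itself a copower (`exists_complement`). Every
object is a subquotient of a copower, so it maps to a copower with torsion kernel and cokernel
(`exists_isoModSerre`), and `j^*` is essentially surjective on copowers.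

*Copowers and `D`-modules.* `Hom(E, ∐_J E)` is a right `D`-module with basis the coprojections
(`homCopowerBasis`), because `E` is compact relative to its copowers. All modules over a division
ring are free, so `Hom(E, -)` is an equivalence from copowers to right `D`-modules. Composing the
two equivalences gives `genericPointEquivalence`.

*Rank.* If `M` maps to `∐_J E` with torsion kernel and cokernel, then
`Hom(M, E) ≅ Hom(∐_J E, E) ≅ D^J` has length the cardinality of `J`, read in `ℕ∞`, and so has the
free right module on `J`. Any two equivalences from `GenericPoint E` to right `D`-modules differ by
a self-equivalence of the module category, which preserves lengths (`length_equivalence_obj`).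
-/

namespace NCSpace

/-! ### Maps from noetherian objects into coproducts -/

section FiniteSupport

variable {C : Type u} [Category.{v} C] [Abelian C]

lemma eq_of_forall_noetherian [IsLocallyNoetherian C] {X Y : C} {f g : X ⟶ Y}
    (h : ∀ (G : C) [IsNoetherianObject G] (a : G ⟶ X), a ≫ f = a ≫ g) : f = g := by
  obtain ⟨ι, G, hG, hs⟩ := IsLocallyNoetherian.exists_generators (C := C)
  refine hs f g ?_
  rintro _ ⟨i⟩ a
  have := hG i
  exact h _ a

variable [IsGrothendieckAbelian.{v} C]

/-- If a noetherian object is the union of a filtered family of subobjects, then it is equal to one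
of them. -/
lemma exists_isIso_of_isNoetherianObject {X : C} [IsNoetherianObject X] {J : Type v}
    [SmallCategory J] [IsFiltered J] (F : J ⥤ MonoOver X)
    {c : Cocone (F ⋙ MonoOver.forget _ ⋙ Over.forget _)} (hc : IsColimit c)
    (f : c.pt ⟶ X) (hf : ∀ j, c.ι.app j ≫ f = (F.obj j).obj.hom) (hepi : Epi f) :
    ∃ j, IsIso (F.obj j).obj.hom := by
  have := IsGrothendieckAbelian.mono_of_isColimit_monoOver F hc f hf
  have htop := (Subobject.epi_iff_mk_eq_top f).1 hepi
  rw [IsGrothendieckAbelian.subobjectMk_of_isColimit_eq_iSup F hc f hf] at htop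
  let s (j : J) : Subobject X := Subobject.mk (F.obj j).obj.hom
  obtain ⟨_, ⟨j, rfl⟩, hj⟩ := WellFounded.has_min (wellFounded_gt (α := Subobject X))
    (Set.range s) ⟨_, IsFiltered.nonempty.some, rfl⟩
  refine ⟨j, (Subobject.isIso_iff_mk_eq_top _).2 (top_le_iff.1 (htop ▸ iSup_le fun i => ?_))⟩
  have hi := MonoOver.subobjectMk_le_mk_of_hom (F.map (IsFiltered.leftToMax i j))
  have hj' : s j ≤ s (IsFiltered.max i j) :=
    MonoOver.subobjectMk_le_mk_of_hom (F.map (IsFiltered.rightToMax i j))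
  exact hi.trans (le_of_eq (hj'.eq_of_not_lt (hj _ ⟨_, rfl⟩)).symm)

open CoproductsFromFiniteFiltered IsGrothendieckAbelian.IsPresentable in
/-- A morphism from a noetherian object `G` to a coproduct factors through a finite subcoproduct: by
exactness of filtered colimits, `G` is the filtered union of the preimages of the finite
subcoproducts. -/
lemma exists_eq_sum_comp_ι {J : Type v} (X : J → C) {G : C} [IsNoetherianObject G]
    (f : G ⟶ ∐ X) :
    ∃ (s : Finset J) (h : ∀ j, G ⟶ X j), f = ∑ j ∈ s, h j ≫ Sigma.ι X j := by
  classical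
  have hc := isColimitFiniteSubproductsCocone X
  have hmono (S : Finset (Discrete J)) : Mono ((finiteSubcoproductsCocone X).ι.app S) := by
    refine (SplitMono.mk (Sigma.desc fun j =>
      if h : (⟨j⟩ : Discrete J) ∈ S then
        Sigma.ι (fun x : S => (Discrete.functor X).obj x) ⟨⟨j⟩, h⟩ else 0) ?_).mono
    refine Sigma.hom_ext _ _ fun j => ?_
    simp
  have := NatTrans.mono_of_mono_app (finiteSubcoproductsCocone X).ι
  -- `f` with its target displayed as the point of the colimit cocone
  let z : G ⟶ (finiteSubcoproductsCocone X).pt := f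
  obtain ⟨S, hS⟩ := exists_isIso_of_isNoetherianObject (surjectivity.F z)
    (colimit.isColimit _) (surjectivity.f z) (surjectivity.hf z) (surjectivity.epi_f hc z)
  obtain ⟨A, q, _, r, hr⟩ : ∃ (A : C) (q : A ⟶ G) (_ : IsIso q) (r : A ⟶ ∐ fun x : S => X x.1.as),
      q ≫ f = r ≫ Sigma.desc fun x : S => Sigma.ι X x.1.as :=
    ⟨_, _, hS, (pullback.fst (finiteSubcoproductsCocone X).ι ((Functor.const _).map z)).app S,
      (NatTrans.congr_app (pullback.condition (f := (finiteSubcoproductsCocone X).ι)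
        (g := (Functor.const _).map z)) S).symm⟩
  obtain ⟨y, hy⟩ : ∃ y : G ⟶ ∐ fun x : S => X x.1.as,
      f = y ≫ Sigma.desc fun x : S => Sigma.ι X x.1.as :=
    ⟨inv q ≫ r, by rw [Category.assoc, ← hr, IsIso.inv_hom_id_assoc]⟩
  let p (j : J) : (∐ fun x : S => X x.1.as) ⟶ X j :=
    Sigma.desc fun x : S => if h : x.1.as = j then eqToHom (by subst h; rfl) else 0
  refine ⟨S.image Discrete.as, fun j => y ≫ p j, ?_⟩
  simp only [Category.assoc]
  rw [hy, ← Preadditive.comp_sum]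
  congr 1
  refine Sigma.hom_ext _ _ fun x => ?_
  rw [Preadditive.comp_sum, Finset.sum_eq_single x.1.as]
  · simp [p]
  · intro j _ hj
    simp [p, Ne.symm hj]
  · intro h
    exact absurd (Finset.mem_image_of_mem _ x.2) h

end FiniteSupport

/-! ### Coordinates of a morphism into a coproduct -/

section Coordinates

variable {C : Type u} [Category.{v} C] [Abelian C]

/-- A monomorphism through which every morphism from a noetherian object factors is an
isomorphism. -/
lemma isIso_of_forall_noetherian [IsLocallyNoetherian C] {X Y : C} (f : X ⟶ Y) [Mono f]
    (h : ∀ (G : C) [IsNoetherianObject G] (b : G ⟶ Y), ∃ a : G ⟶ X, a ≫ f = b) : IsIso f := by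
  obtain ⟨ι, G, hG, hs⟩ := IsLocallyNoetherian.exists_generators (C := C)
  refine hs.isDetecting f ?_
  rintro _ ⟨i⟩ b
  have := hG i
  obtain ⟨a, ha⟩ := h _ b
  exact ⟨a, ha, fun a' ha' => by rw [← cancel_mono f, ha, ha']⟩

variable [IsGrothendieckAbelian.{v} C] {J : Type v} [DecidableEq J] {X : J → C}

lemma exists_eq_sum_π {G : C} [IsNoetherianObject G] (f : G ⟶ ∐ X) :
    ∃ s : Finset J, f = ∑ j ∈ s, (f ≫ Sigma.π X j) ≫ Sigma.ι X j ∧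
      ∀ j ∉ s, f ≫ Sigma.π X j = 0 := by
  obtain ⟨s, h, hf⟩ := exists_eq_sum_comp_ι X f
  have hπ (i : J) : f ≫ Sigma.π X i = if i ∈ s then h i else 0 := by
    rw [hf, Preadditive.sum_comp]
    split_ifs with hi
    · rw [Finset.sum_eq_single_of_mem i hi]
      · simp
      · intro j _ hj
        rw [Category.assoc, Sigma.ι_π_of_ne X hj, comp_zero]
    · refine Finset.sum_eq_zero fun j hj => ?_
      rw [Category.assoc, Sigma.ι_π_of_ne X (fun e : j = i => hi (e ▸ hj)), comp_zero]
  refine ⟨s, ?_, fun j hj => by simp [hπ, hj]⟩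
  conv_lhs => rw [hf]
  exact Finset.sum_congr rfl fun j hj => by simp [hπ, hj]

variable [IsLocallyNoetherian C]

lemma comp_eq_zero_of_forall_coordinate {A T : C} (x : A ⟶ ∐ X) (g : ∐ X ⟶ T)
    (h : ∀ j, x ≫ Sigma.π X j ≫ Sigma.ι X j ≫ g = 0) : x ≫ g = 0 := by
  refine eq_of_forall_noetherian fun G _ a => ?_
  obtain ⟨s, hs, -⟩ := exists_eq_sum_π (a ≫ x)
  rw [← Category.assoc, hs, Preadditive.sum_comp, comp_zero]
  exact Finset.sum_eq_zero fun j _ => by simp [h]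

/-- The projections from a coproduct to its summands are jointly monic. -/
lemma hom_ext_π {A : C} {f g : A ⟶ ∐ X}
    (h : ∀ j, f ≫ Sigma.π X j = g ≫ Sigma.π X j) : f = g := by
  rw [← sub_eq_zero, ← Category.comp_id (f - g)]
  refine comp_eq_zero_of_forall_coordinate _ _ fun j => ?_
  rw [← Category.assoc, Preadditive.sub_comp, h, sub_self, zero_comp]

end Coordinates

/-! ### The actions of the endomorphism ring on morphisms -/

section Smul

variable {C : Type u} [Category.{v} C] [Preadditive C]

lemma op_smul_eq {E X : C} (d : (End E)ᵐᵒᵖ) (x : E ⟶ X) : d • x = (d.unop : E ⟶ E) ≫ x := rfl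

lemma end_smul_eq {E X : C} (d : End E) (x : X ⟶ E) : d • x = x ≫ (d : E ⟶ E) := rfl

end Smul

/-! ### Copowers of an injective object are closed for its torsion theory -/

section Torsion

variable {C : Type u} [Category.{v} C] [Abelian C] {E : C} [Injective E]

lemma eq_zero_of_epiModSerre {A B : C} {w : A ⟶ B} (hw : (torsion E).epiModSerre w)
    {g : B ⟶ E} (h : w ≫ g = 0) : g = 0 := by
  rw [← cokernel.π_desc w g h, hw (cokernel.desc w g h), comp_zero]

/-- A morphism vanishing on the kernel of `w` factors through the image of `w`. -/
lemma exists_factor_image {A B T : C} (w : A ⟶ B) (f : A ⟶ T) (h : kernel.ι w ≫ f = 0) :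
    ∃ f' : Abelian.image w ⟶ T, Abelian.factorThruImage w ≫ f' = f := by
  refine ⟨Abelian.epiDesc (Abelian.factorThruImage w) f ?_, Abelian.comp_epiDesc _ _ _⟩
  have h0 : kernel.ι (Abelian.factorThruImage w) ≫ w = 0 := by
    trans kernel.ι (Abelian.factorThruImage w) ≫ Abelian.factorThruImage w ≫ Abelian.image.ι w
    · rw [Abelian.image.fac]
    · rw [kernel.condition_assoc, zero_comp]
  rw [← kernel.lift_ι w _ h0, Category.assoc, h, comp_zero]

lemma exists_extension_injective {A B : C} {w : A ⟶ B} (hw : (torsion E).monoModSerre w)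
    (f : A ⟶ E) : ∃ h : B ⟶ E, w ≫ h = f := by
  obtain ⟨f', hf'⟩ := exists_factor_image w f (hw _)
  obtain ⟨h, hh⟩ := Injective.factors f' (Abelian.image.ι w)
  exact ⟨h, by rw [← hf', ← hh, ← Category.assoc, Abelian.image.fac]⟩

variable (E) in
lemma rank_eq_of_isoModSerre {M N : C} {m : M ⟶ N} (hm : (torsion E).isoModSerre m) :
    rank E M = rank E N := by
  let φ : (N ⟶ E) →ₗ[End E] (M ⟶ E) :=
    { toFun g := m ≫ g
      map_add' _ _ := by simp
      map_smul' _ _ := by simp [end_smul_eq] }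
  refine (LinearEquiv.ofBijective φ
    ⟨?_, fun f => exists_extension_injective hm.1 f⟩).length_eq.symm
  exact (injective_iff_map_eq_zero φ).2 fun g hg => eq_zero_of_epiModSerre hm.2 hg

variable [IsGrothendieckAbelian.{v} C] [IsLocallyNoetherian C] {J : Type v}

lemma eq_of_epiModSerre_comp_eq {A B : C} {w : A ⟶ B} (hw : (torsion E).epiModSerre w)
    {f g : B ⟶ ∐ fun _ : J => E} (h : w ≫ f = w ≫ g) : f = g := by
  classical
  refine hom_ext_π fun j => sub_eq_zero.1 (eq_zero_of_epiModSerre hw ?_)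
  rw [Preadditive.comp_sub, reassoc_of% h, sub_self]

/-- The extension is built coordinatewise as a morphism `H` to the product of copies of `E`. On a
noetherian subobject of `B` almost all of its coordinates vanish, because they vanish modulo
torsion; hence `H` factors through the coproduct. -/
lemma exists_extension_of_mono {A B : C} {w : A ⟶ B} [Mono w]
    (hw : (torsion E).isoModSerre w) (f : A ⟶ ∐ fun _ : J => E) :
    ∃ h : B ⟶ ∐ fun _ : J => E, w ≫ h = f := by
  classical
  choose h hh using fun j => exists_extension_injective hw.1 (f ≫ Sigma.π (fun _ : J => E) j)
  let H : B ⟶ ∏ᶜ fun _ : J => E := Pi.lift h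
  let I : (∐ fun _ : J => E) ⟶ ∏ᶜ fun _ : J => E := Pi.lift fun j => Sigma.π _ j
  have hI : Mono I := ⟨fun a b hab => hom_ext_π fun j => by
    simpa [I] using hab =≫ Pi.π (fun _ : J => E) j⟩
  have : IsIso (pullback.fst H I) := by
    refine isIso_of_forall_noetherian _ fun G _ b => ?_
    have := isNoetherianObject_of_mono (pullback.snd w b)
    obtain ⟨s, -, hs⟩ := exists_eq_sum_π (pullback.fst w b ≫ f)
    have hb (j : J) (hj : j ∉ s) : b ≫ h j = 0 := by
      refine eq_zero_of_epiModSerre (w := pullback.snd w b)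
        (MorphismProperty.pullback_snd _ _ hw).2 ?_
      rw [← pullback.condition_assoc, hh, ← hs j hj, Category.assoc]
    -- `b ≫ H` has finitely many nonzero coordinates, so their sum lifts it to the coproduct
    refine ⟨pullback.lift b (∑ j ∈ s, (b ≫ h j) ≫ Sigma.ι (fun _ : J => E) j) ?_,
      pullback.lift_fst _ _ _⟩
    refine Pi.hom_ext _ _ fun i => ?_
    simp only [H, I, Category.assoc, Pi.lift_π]
    rw [Preadditive.sum_comp]
    by_cases hi : i ∈ s
    · rw [Finset.sum_eq_single_of_mem i hi]
      · simp
      · intro j _ hj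
        simp [Sigma.ι_π_of_ne (fun _ : J => E) hj]
    · rw [hb i hi]
      refine (Finset.sum_eq_zero fun j hj => ?_).symm
      simp [Sigma.ι_π_of_ne (fun _ : J => E) (fun e => hi (e ▸ hj) : j ≠ i)]
  refine ⟨inv (pullback.fst H I) ≫ pullback.snd H I, hom_ext_π fun j => ?_⟩
  have hπ : pullback.snd H I ≫ Sigma.π (fun _ : J => E) j = pullback.fst H I ≫ h j := by
    simpa [H, I] using (pullback.condition (f := H) (g := I)).symm =≫ Pi.π (fun _ : J => E) j
  rw [← hh j, Category.assoc, Category.assoc, hπ, IsIso.inv_hom_id_assoc]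

/-- Copowers of the injective object `E` are closed for the torsion theory of `E`: together with
`eq_of_epiModSerre_comp_eq`, every morphism extends uniquely along a morphism whose kernel and
cokernel are torsion. -/
lemma exists_extension {A B : C} {w : A ⟶ B}
    (hw : (torsion E).isoModSerre w) (f : A ⟶ ∐ fun _ : J => E) :
    ∃ h : B ⟶ ∐ fun _ : J => E, w ≫ h = f := by
  classical
  obtain ⟨f', hf'⟩ := exists_factor_image w f (hom_ext_π fun j => by
    rw [Category.assoc, zero_comp]
    exact hw.1 _)
  obtain ⟨h, hh⟩ := exists_extension_of_mono hw.2.isoModSerre_image_ι f'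
  exact ⟨h, by rw [← hf', ← hh, ← Category.assoc, Abelian.image.fac]⟩

end Torsion

/-! ### Big injectives -/

section BigInjective

variable {C : Type u} [Category.{v} C] [Abelian C] [IsGrothendieckAbelian.{v} C]
  {E : C} [IsBigInjective E]

lemma isIso_of_ne_zero {f : E ⟶ E} (hf : f ≠ 0) : IsIso f :=
  (isUnit_iff_isIso f).1 (IsBigInjective.isUnit_of_ne_zero f hf)

variable (E)

/-- The endomorphism ring of a big injective, as a division ring extending its ring structure. -/
noncomputable abbrev divisionRingEnd : DivisionRing (End E) :=
  have : Nontrivial (End E) := ⟨𝟙 E, 0, fun h =>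
    (IsBigInjective.indecomposable (E := E)).1 ((IsZero.iff_id_eq_zero E).2 h)⟩
  DivisionRing.ofIsUnitOrEqZero fun f => by
    by_cases hf : f = 0
    · exact Or.inr hf
    · exact Or.inl (IsBigInjective.isUnit_of_ne_zero f hf)

/-- The opposite of the endomorphism ring of a big injective, as a division ring extending its ring
structure. -/
noncomputable abbrev divisionRingEndOp : DivisionRing (End E)ᵐᵒᵖ :=
  letI := divisionRingEnd E
  inferInstance

lemma rank_copower (J : Type v) : rank E (∐ fun _ : J => E) = ENat.card J := by
  let := divisionRingEnd E
  let φ : ((∐ fun _ : J => E) ⟶ E) ≃ₗ[End E] (J → End E) :=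
    { toFun g j := Sigma.ι (fun _ : J => E) j ≫ g
      invFun g := Sigma.desc g
      map_add' _ _ := by ext; simp
      map_smul' _ _ := by ext; simp [end_smul_eq]
      left_inv _ := Sigma.hom_ext _ _ fun _ => by simp
      right_inv _ := by ext; simp }
  rw [rank, φ.length_eq, Module.length_pi, Module.length_eq_one, mul_one]

end BigInjective

/-! ### Every object is a copower of the big injective up to torsion -/

section Reflection

variable {C : Type u} [Category.{v} C] [Abelian C] [IsGrothendieckAbelian.{v} C]
  [IsLocallyNoetherian C] {E : C} [IsBigInjective E] {J : Type v}

/-- Up to torsion, the image of `k` in a copower of `E` is complemented by the subcopower indexed by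
some subset `F`: the two meet trivially, and a morphism to `E` vanishing on both is zero. The set
`F` is obtained by Zorn's lemma as a maximal one whose subcopower meets it trivially. Membership in
the subcopower indexed by `F` is expressed by the vanishing of the coordinates outside `F`. -/
lemma exists_complement [DecidableEq J] {K : C} (k : K ⟶ ∐ fun _ : J => E) :
    ∃ F : Set J,
      (∀ (G : C) (a : G ⟶ K), (∀ j ∉ F, a ≫ k ≫ Sigma.π (fun _ : J => E) j = 0) →
        a ≫ k = 0) ∧
      ∀ g : (∐ fun _ : J => E) ⟶ E, k ≫ g = 0 →
        (∀ j ∈ F, Sigma.ι (fun _ : J => E) j ≫ g = 0) → g = 0 := by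
  let S : Set (Set J) := {F | ∀ (G : C) (a : G ⟶ K),
    (∀ j ∉ F, a ≫ k ≫ Sigma.π (fun _ : J => E) j = 0) → a ≫ k = 0}
  obtain ⟨F, hF⟩ : ∃ F, Maximal (· ∈ S) F := by
    refine zorn_subset S fun c hcS hc => ?_
    obtain rfl | hne := c.eq_empty_or_nonempty
    · refine ⟨∅, fun G a ha => hom_ext_π fun j => ?_, by simp⟩
      rw [Category.assoc, ha j (by simp), zero_comp]
    -- on a noetherian object only finitely many coordinates matter, and those in the union
    -- of the chain lie in a single member of it
    refine ⟨⋃₀ c, fun G a ha => eq_of_forall_noetherian fun G' _ b => ?_,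
      fun _ => Set.subset_sUnion_of_mem⟩
    obtain ⟨s, -, hs⟩ := exists_eq_sum_π (b ≫ a ≫ k)
    obtain ⟨F, hFc, hF⟩ := hc.directedOn.exists_mem_subset_of_finite_of_subset_sUnion hne
      (s.finite_toSet.inter_of_left (⋃₀ c)) Set.inter_subset_right
    rw [comp_zero, ← Category.assoc]
    refine hcS hFc G' (b ≫ a) fun j hj => ?_
    by_cases hjs : j ∈ s
    · rw [Category.assoc, ha j fun h => hj (hF ⟨hjs, h⟩), comp_zero]
    · simpa using hs j hjs
  refine ⟨F, hF.prop, fun g hkg hFg => Sigma.hom_ext _ _ fun j => ?_⟩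
  rw [comp_zero]
  by_contra hj
  have hjF : j ∉ F := fun h => hj (hFg j h)
  have := isIso_of_ne_zero hj
  have hins : insert j F ∉ S := fun h =>
    hjF (hF.le_of_ge h (Set.subset_insert j F) (Set.mem_insert j F))
  apply hins
  intro G a ha
  -- the only coordinate of `a ≫ k` on which `g` does not vanish is the one at `j`
  have h0 : (a ≫ k) ≫ (g - Sigma.π (fun _ : J => E) j ≫ Sigma.ι (fun _ : J => E) j ≫ g) = 0 := by
    refine comp_eq_zero_of_forall_coordinate _ _ fun i => ?_
    by_cases hij : i = j
    · subst hij
      simp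
    by_cases hi : i ∈ F
    · simp [hFg i hi, Sigma.ι_π_of_ne_assoc (fun _ : J => E) hij]
    · rw [Category.assoc, reassoc_of% ha i (by simp [hij, hi]), zero_comp]
  rw [Preadditive.comp_sub, Category.assoc, hkg, comp_zero, zero_sub, neg_eq_zero,
    ← Category.assoc, ← Category.assoc] at h0
  replace h0 := zero_of_comp_mono _ ((Category.assoc _ _ _).symm.trans h0)
  refine hF.prop G a fun i hi => ?_
  by_cases hij : i = j
  · subst hij
    simpa using h0
  · exact ha i (by simp [hij, hi])

/-- Up to torsion, every subobject of a copower of `E` is a copower of `E`: project away from a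
complement. -/
lemma exists_isoModSerre_of_monoModSerre {M : C} {m : M ⟶ ∐ fun _ : J => E}
    (hm : (torsion E).monoModSerre m) :
    ∃ (J' : Type v) (m' : M ⟶ ∐ fun _ : J' => E), (torsion E).isoModSerre m' := by
  classical
  obtain ⟨F, hF, hF'⟩ := exists_complement m
  let q : (∐ fun _ : J => E) ⟶ ∐ fun _ : {j // j ∉ F} => E :=
    Sigma.desc fun j => if h : j ∉ F then Sigma.ι (fun _ : {j // j ∉ F} => E) ⟨j, h⟩ else 0
  let s : (∐ fun _ : {j // j ∉ F} => E) ⟶ ∐ fun _ : J => E :=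
    Sigma.desc fun j => Sigma.ι (fun _ : J => E) j.1
  have hsq : s ≫ q = 𝟙 _ := Sigma.hom_ext _ _ fun j => by simp [s, q, j.2]
  have : Epi q := (SplitEpi.mk s hsq).epi
  have hq (j) (hj : j ∈ F) : Sigma.ι (fun _ : J => E) j ≫ q = 0 := by simp [q, hj]
  have hqπ (j : {j // j ∉ F}) : q ≫ Sigma.π (fun _ : {j // j ∉ F} => E) j =
      Sigma.π (fun _ : J => E) j.1 := by
    refine Sigma.hom_ext _ _ fun i => ?_
    by_cases hi : i ∈ F
    · rw [reassoc_of% hq i hi, zero_comp, Sigma.ι_π_of_ne _ fun e : i = j.1 => j.2 (e ▸ hi)]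
    · by_cases hij : i = j.1
      · subst hij
        simp [q, j.2]
      · simp [q, hi, Sigma.ι_π_of_ne (fun _ : J => E) hij,
          Sigma.ι_π_of_ne (fun _ : {j // j ∉ F} => E) (b := ⟨i, hi⟩) (c := j)
            fun e => hij (congrArg Subtype.val e)]
  refine ⟨{j // j ∉ F}, m ≫ q, ?_, fun g => ?_⟩
  · have h0 : kernel.ι (m ≫ q) ≫ m = 0 := hF _ _ fun j hj => by
      rw [← hqπ ⟨j, hj⟩, ← Category.assoc m q, kernel.condition_assoc, zero_comp]
    have : Mono (kernel.lift m _ h0) := mono_of_mono_fac (kernel.lift_ι m _ h0)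
    exact (torsion E).prop_of_mono (kernel.lift m _ h0) hm
  · rw [← cancel_epi (cokernel.π (m ≫ q)), ← cancel_epi q, comp_zero, comp_zero]
    refine hF' _ ?_ fun j hj => by rw [reassoc_of% hq j hj, zero_comp]
    rw [← Category.assoc m, cokernel.condition_assoc, zero_comp]

/-- Up to torsion, every quotient of a copower of `E` is a copower of `E`: a complement `s` of the
kernel of `c` maps to `P` with torsion kernel and cokernel, and it is a retract of `P` since
copowers are closed. -/
lemma exists_isoModSerre_of_epi {P : C} (c : (∐ fun _ : J => E) ⟶ P) [Epi c] :
    ∃ (J' : Type v) (r : P ⟶ ∐ fun _ : J' => E), (torsion E).isoModSerre r := by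
  classical
  obtain ⟨F, hF, hF'⟩ := exists_complement (kernel.ι c)
  let s : (∐ fun _ : F => E) ⟶ ∐ fun _ : J => E :=
    Sigma.desc fun j => Sigma.ι (fun _ : J => E) j.1
  have hsπ (j : J) (hj : j ∉ F) : s ≫ Sigma.π (fun _ : J => E) j = 0 :=
    Sigma.hom_ext _ _ fun i => by
      simp [s, Sigma.ι_π_of_ne (fun _ : J => E) (fun e => hj (e ▸ i.2) : i.1 ≠ j)]
  have hsπ' (j : F) : s ≫ Sigma.π (fun _ : J => E) j.1 = Sigma.π (fun _ : F => E) j :=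
    Sigma.hom_ext _ _ fun i => by
      by_cases hij : i = j
      · subst hij
        simp [s]
      · simp [s, Sigma.ι_π_of_ne (fun _ : F => E) hij,
          Sigma.ι_π_of_ne (fun _ : J => E) (fun e => hij (Subtype.ext e) : i.1 ≠ j.1)]
  have : Mono (s ≫ c) := Preadditive.mono_of_cancel_zero _ fun {G} a ha => by
    rw [← Category.assoc] at ha
    have has : a ≫ s = 0 := by
      rw [← kernel.lift_ι c (a ≫ s) ha]
      refine hF _ _ fun j hj => ?_
      rw [kernel.lift_ι_assoc, Category.assoc, hsπ j hj, comp_zero]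
    refine hom_ext_π fun j => ?_
    rw [← hsπ' j, reassoc_of% has, zero_comp, zero_comp]
  have hi : (torsion E).isoModSerre (s ≫ c) := by
    refine (torsion E).isoModSerre_of_mono _ fun g => ?_
    rw [← cancel_epi (cokernel.π (s ≫ c)), ← cancel_epi c, comp_zero, comp_zero]
    refine hF' _ (by simp) fun j hj => ?_
    have hj' : Sigma.ι (fun _ : J => E) j = Sigma.ι (fun _ : F => E) ⟨j, hj⟩ ≫ s := by
      simp [s]
    rw [hj', Category.assoc, ← Category.assoc s, cokernel.condition_assoc, zero_comp, comp_zero]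
  obtain ⟨r, hr⟩ := exists_extension hi (𝟙 _)
  exact ⟨F, r, MorphismProperty.of_precomp _ (s ≫ c) r hi
    (hr ▸ (torsion E).isoModSerre.id_mem _)⟩

variable (E) in
lemma exists_isoModSerre (M : C) :
    ∃ (J : Type v) (m : M ⟶ ∐ fun _ : J => E), (torsion E).isoModSerre m := by
  obtain ⟨J, S, i, p, _, _⟩ := IsBigInjective.isSubquotient (E := E) M
  obtain ⟨J', r, hr⟩ := exists_isoModSerre_of_epi (pushout.inr p i)
  exact exists_isoModSerre_of_monoModSerre ((torsion E).monoModSerre.comp_mem _ r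
    ((torsion E).monoModSerre_of_mono (pushout.inl p i)) hr.1)

end Reflection

/-! ### Length and equivalences of module categories -/

section Length

/-- Any equivalence of module categories preserves length, as it preserves lattices of
subobjects. -/
lemma length_equivalence_obj {R S : Type*} [Ring R] [Ring S]
    (e : ModuleCat.{v} R ≌ ModuleCat.{v} S) (M : ModuleCat.{v} R) :
    Module.length S (e.functor.obj M) = Module.length R M := by
  rw [← WithBot.coe_inj, Module.coe_length, Module.coe_length]
  exact (Order.krullDim_eq_of_orderIso ((ModuleCat.subobjectModule M).symm.trans
    ((Subobject.lowerEquivalence (MonoOver.congr M e)).toOrderIso.trans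
      (ModuleCat.subobjectModule _)))).symm

end Length

/-! ### Modules over the generic point -/

section Copower

variable {C : Type u} [Category.{v} C] [Abelian C] [IsGrothendieckAbelian.{v} C]

/-- The full subcategory of the copowers of `E`. Its objects are the index types `J : Type v`, with
`J` standing for the coproduct of `J` copies of `E`. -/
abbrev Copowers (E : C) : Type (v + 1) :=
  InducedCategory C fun J : Type v => ∐ fun _ : J => E

/-- The inclusion of the category of copowers of `E`. -/
noncomputable abbrev copowersFunctor (E : C) : Copowers E ⥤ C :=
  inducedFunctor fun J : Type v => ∐ fun _ : J => E

variable (E : C) [IsBigInjective E] [IsLocallyNoetherian C]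

variable {E} in
lemma exists_noetherian_ne_zero :
    ∃ (G : C) (_ : IsNoetherianObject G) (n : G ⟶ E), n ≠ 0 := by
  by_contra! h
  refine (IsBigInjective.indecomposable (E := E)).1 ((IsZero.iff_id_eq_zero E).2 ?_)
  exact eq_of_forall_noetherian fun G hG a => by rw [h G hG a, zero_comp, zero_comp]

variable {E} in
/-- A big injective is compact with respect to its own copowers: a coordinate of `x` that vanishes
on a nonzero noetherian subobject of `E` is not invertible, hence it is zero. -/
lemma exists_eq_sum_π_of_isBigInjective {J : Type v} [DecidableEq J]
    (x : E ⟶ ∐ fun _ : J => E) :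
    ∃ s : Finset J, x = ∑ j ∈ s, (x ≫ Sigma.π (fun _ : J => E) j) ≫
      Sigma.ι (fun _ : J => E) j := by
  obtain ⟨G, _, n, hn⟩ := exists_noetherian_ne_zero (E := E)
  obtain ⟨s, -, hs⟩ := exists_eq_sum_π (n ≫ x)
  refine ⟨s, hom_ext_π fun i => ?_⟩
  rw [Preadditive.sum_comp]
  by_cases hi : i ∈ s
  · rw [Finset.sum_eq_single_of_mem i hi]
    · simp
    · intro j _ hj
      rw [Category.assoc, Sigma.ι_π_of_ne _ hj, comp_zero]
  · rw [Finset.sum_eq_zero fun j hj => by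
      rw [Category.assoc, Sigma.ι_π_of_ne _ fun e : j = i => hi (e ▸ hj), comp_zero]]
    by_contra h
    have := isIso_of_ne_zero h
    exact hn (zero_of_comp_mono (x ≫ Sigma.π (fun _ : J => E) i) (by simpa using hs i hi))

/-- The coprojections form a basis of the right `End E`-module of morphisms from `E` to a copower
of `E`. -/
noncomputable def homCopowerBasis (J : Type v) :
    Module.Basis J (End E)ᵐᵒᵖ (E ⟶ ∐ fun _ : J => E) := by
  classical
  refine Module.Basis.mk (v := fun j => Sigma.ι (fun _ : J => E) j) ?_ ?_
  · rw [linearIndependent_iff]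
    intro l hl
    ext j
    apply MulOpposite.unop_injective
    have := hl =≫ Sigma.π (fun _ : J => E) j
    rw [Finsupp.linearCombination_apply, Finsupp.sum, Preadditive.sum_comp,
      Finset.sum_eq_single j] at this
    · simpa [op_smul_eq] using this
    · intro i _ hij
      rw [op_smul_eq, Category.assoc, Sigma.ι_π_of_ne _ hij, comp_zero]
    · intro hj
      simp [Finsupp.notMem_support_iff.1 hj]
  · intro x _
    obtain ⟨s, hs⟩ := exists_eq_sum_π_of_isBigInjective x
    rw [hs]
    exact Submodule.sum_mem _ fun j _ =>
      Submodule.smul_mem _ (M := E ⟶ ∐ fun _ : J => E)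
        (MulOpposite.op (show End E from x ≫ Sigma.π (fun _ : J => E) j))
        (Submodule.subset_span ⟨j, rfl⟩)

instance : (copowersFunctor E ⋙ preadditiveCoyonedaObj E).Faithful where
  map_injective {I J} f g h := by
    apply InducedCategory.hom_ext
    refine Sigma.hom_ext _ _ fun i => ?_
    exact ConcreteCategory.congr_hom h (Sigma.ι (fun _ : I => E) i)

instance : (copowersFunctor E ⋙ preadditiveCoyonedaObj E).Full where
  map_surjective {I J} φ := by
    refine ⟨InducedCategory.homMk (Sigma.desc fun i => φ (Sigma.ι (fun _ : I => E) i)), ?_⟩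
    ext : 1
    refine (homCopowerBasis E I).ext fun i => ?_
    rw [homCopowerBasis, Module.Basis.mk_apply]
    exact Sigma.ι_desc _ _

instance : (copowersFunctor E ⋙ preadditiveCoyonedaObj E).EssSurj where
  mem_essImage V := by
    let := divisionRingEndOp E
    let b := Module.Basis.ofVectorSpace (End E)ᵐᵒᵖ V
    exact ⟨_, ⟨((homCopowerBasis E _).equiv b (Equiv.refl _)).toModuleIso⟩⟩

instance : (copowersFunctor E ⋙ toGenericPoint E).Faithful where
  map_injective {I J} f g h := by
    apply InducedCategory.hom_ext
    obtain ⟨Z, s, hs, hfg⟩ := (MorphismProperty.map_eq_iff_postcomp (toGenericPoint E)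
      (torsion E).isoModSerre f.hom g.hom).1 h
    obtain ⟨t, ht⟩ := exists_extension hs (𝟙 _)
    have := hfg =≫ t
    simpa [ht] using this

instance : (copowersFunctor E ⋙ toGenericPoint E).Full where
  map_surjective {I J} φ := by
    obtain ⟨ψ, hψ⟩ := Localization.exists_leftFraction (toGenericPoint E)
      (torsion E).isoModSerre φ
    obtain ⟨t, ht⟩ := exists_extension ψ.hs (𝟙 _)
    refine ⟨InducedCategory.homMk (ψ.f ≫ t), ?_⟩
    -- the inverse of `ψ.s` in the localization comes from the retraction `t`
    have hst : (toGenericPoint E).map ψ.s ≫ (toGenericPoint E).map t = 𝟙 _ := by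
      rw [← CategoryTheory.Functor.map_comp, ht, CategoryTheory.Functor.map_id]
    rw [hψ, ← Category.comp_id (ψ.map _ _)]
    erw [← hst]
    rw [MorphismProperty.LeftFraction.map_comp_map_s_assoc]
    exact (toGenericPoint E).map_comp ψ.f t

instance : (copowersFunctor E ⋙ toGenericPoint E).EssSurj where
  mem_essImage N := by
    obtain ⟨M, ⟨i⟩⟩ := (Localization.essSurj (toGenericPoint E)
      (torsion E).isoModSerre).mem_essImage N
    obtain ⟨J, m, hm⟩ := exists_isoModSerre E M
    have := Localization.inverts (toGenericPoint E) _ _ hm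
    exact ⟨J, ⟨(asIso ((toGenericPoint E).map m)).symm ≪≫ i⟩⟩

/-- The equivalence between the modules over the generic point and the right modules over the
function field: both are equivalent to the category of copowers of `E`, through `j^*` and through
`Hom(E, -)`. -/
noncomputable def genericPointEquivalence : GenericPoint E ≌ ModuleCat.{v} (functionField E)ᵐᵒᵖ :=
  have : (copowersFunctor E ⋙ toGenericPoint E).IsEquivalence := {}
  have : (copowersFunctor E ⋙ preadditiveCoyonedaObj E).IsEquivalence := {}
  (copowersFunctor E ⋙ toGenericPoint E).asEquivalence.symm.trans
    (copowersFunctor E ⋙ preadditiveCoyonedaObj E).asEquivalence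

/-- The equivalence `genericPointEquivalence` sends the image of a copower of `E` to the module of
morphisms from `E` to it. -/
noncomputable def genericPointEquivalenceObj (J : Type v) :
    (genericPointEquivalence E).functor.obj ((toGenericPoint E).obj (∐ fun _ : J => E)) ≅
      ModuleCat.of (End E)ᵐᵒᵖ (E ⟶ ∐ fun _ : J => E) :=
  have : (copowersFunctor E ⋙ toGenericPoint E).IsEquivalence := {}
  (copowersFunctor E ⋙ preadditiveCoyonedaObj E).mapIso
    ((copowersFunctor E ⋙ toGenericPoint E).asEquivalence.unitIso.app J).symm

section Linear

variable (k : Type w) [CommRing k] [Linear k C]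

instance : (preadditiveCoyonedaObj E).Linear k where
  map_smul f r := by
    ext x
    change x ≫ (r • f) = (algebraMap k (End E)ᵐᵒᵖ r) • (x ≫ f)
    rw [op_smul_eq, MulOpposite.algebraMap_apply, MulOpposite.unop_op,
      Algebra.algebraMap_eq_smul_one]
    change _ = (r • 𝟙 E) ≫ _
    rw [Linear.smul_comp, Category.id_comp]
    exact Linear.comp_smul _ _ _ x r f

instance : (genericPointEquivalence E).functor.Additive := by
  have : (copowersFunctor E ⋙ toGenericPoint E).IsEquivalence := {}
  have : (copowersFunctor E ⋙ toGenericPoint E).asEquivalence.functor.Additive :=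
    inferInstanceAs (copowersFunctor E ⋙ toGenericPoint E).Additive
  exact inferInstanceAs ((copowersFunctor E ⋙ toGenericPoint E).asEquivalence.inverse ⋙
    (copowersFunctor E ⋙ preadditiveCoyonedaObj E)).Additive

instance : (genericPointEquivalence E).functor.Linear k := by
  have : (copowersFunctor E ⋙ toGenericPoint E).IsEquivalence := {}
  have : (copowersFunctor E ⋙ toGenericPoint E).asEquivalence.functor.Additive :=
    inferInstanceAs (copowersFunctor E ⋙ toGenericPoint E).Additive
  have : (copowersFunctor E ⋙ toGenericPoint E).asEquivalence.functor.Linear k :=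
    inferInstanceAs ((copowersFunctor E ⋙ toGenericPoint E).Linear k)
  exact inferInstanceAs (((copowersFunctor E ⋙ toGenericPoint E).asEquivalence.inverse ⋙
    (copowersFunctor E ⋙ preadditiveCoyonedaObj E)).Linear k)

end Linear

lemma length_genericPoint_copower (e : GenericPoint E ≌ ModuleCat.{v} (functionField E)ᵐᵒᵖ)
    (J : Type v) :
    Module.length (functionField E)ᵐᵒᵖ
      (e.functor.obj ((toGenericPoint E).obj (∐ fun _ : J => E))) = ENat.card J := by
  let e' := e.symm.trans (genericPointEquivalence E)
  have i := (genericPointEquivalence E).functor.mapIso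
    (e.unitIso.app ((toGenericPoint E).obj (∐ fun _ : J => E))).symm ≪≫
      genericPointEquivalenceObj E J
  let := divisionRingEndOp E
  refine (length_equivalence_obj e' _).symm.trans (i.toLinearEquiv.length_eq.trans ?_)
  rw [(homCopowerBasis E J).repr.length_eq, Module.length_finsupp, Module.length_eq_one, mul_one]

end Copower
end NCSpace

theorem mainTheorem3 (k : Type w) [CommRing k]
    (C : Type u) [Category.{v} C] [Abelian C] [Linear k C] [IsGrothendieckAbelian.{v} C]
    [NCSpace.IsIntegralSpace C] (E : C) [NCSpace.IsBigInjective E] :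
    (∃ e : NCSpace.GenericPoint E ≌ ModuleCat.{v} (NCSpace.functionField E)ᵐᵒᵖ,
      e.functor.Additive ∧ e.functor.Linear k) ∧
    ∀ (e : NCSpace.GenericPoint E ≌ ModuleCat.{v} (NCSpace.functionField E)ᵐᵒᵖ) (M : C),
      NCSpace.rank E M =
        Module.length (NCSpace.functionField E)ᵐᵒᵖ
          (e.functor.obj ((NCSpace.toGenericPoint E).obj M)) := by
  refine ⟨⟨NCSpace.genericPointEquivalence E, inferInstance, inferInstance⟩, fun e M => ?_⟩
  obtain ⟨J, m, hm⟩ := NCSpace.exists_isoModSerre E M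
  have := Localization.inverts (NCSpace.toGenericPoint E) _ _ hm
  rw [NCSpace.rank_eq_of_isoModSerre E hm, NCSpace.rank_copower,
    ← NCSpace.length_genericPoint_copower E e,
    (e.functor.mapIso (asIso ((NCSpace.toGenericPoint E).map m))).toLinearEquiv.length_eq]
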